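/- **Setting.** For a linear map $T$ on $d\times d$ complex matrices let $\|T\|_{1\to1}=\sup_{A\ne0}\|T(A)\|_1/\|A\|_1$, where $\|\cdot\|_1$ is the trace norm, and call a linear map $\mathcal L$ a GKSL generator if $e^{s\mathcal L}$ is completely positive and trace preserving for all $s\ge0$. For a finite set $X$ let $\mathcal D_X$ be the set of probability distributions on $X$, and $d_{\mathrm{TV}}(P,D)=\tfrac12\sum_{x\in X}|P(x)-D(x)|$. Fix $t,\delta,C_G>0$. A *parameter-sphere ensemble* of parameter dimension $M$ consists of a dimension $d$, a GKSL generator $\mathcal L_{\mathrm{ref}}$ on $\mathbb C^{d\times d}$, linear maps $G_1,\dots,G_M$ on $\mathbb C^{d\times d}$ with $\|G_j\|_{1\to1}\le C_G$, a measurable set $\Theta\subseteq S^{M-1}=\{\theta\in\mathbb R^M:\|\theta\|_2=1\}$ of positive surface measure such that $$\mathcal L(\theta)=\mathcal L_{\mathrm{ref}}+\frac{\delta}{\sqrt M}\sum_{j=1}^M\theta_jG_j$$ is a GKSL generator for every $\theta\in\Theta$, a density matrix $\rho_{\mathrm{in}}$, and a POVM $\{M_x\}_{x\in X}$ with finite outcome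 set $X$. Let $\mu_\Theta$ be the normalized restriction of the surface measure to $\Theta$; drawing $\mathcal L\sim\mu_{\mathcal L}$ means drawing $\theta\sim\mu_\Theta$ and setting $\mathcal L=\mathcal L(\theta)$. The output distribution of $\mathcal L$ is $P_{\mathcal L}(x)=\operatorname{Tr}\bigl(M_x\,e^{t\mathcal L}(\rho_{\mathrm{in}})\bigr)$, and the ensemble average is $Q(x)=\mathbb E_{\mathcal L\sim\mu_{\mathcal L}}P_{\mathcal L}(x)$. **Theorem.** Let $t,\delta,C_G,m_0,c_{\mathrm{par}}>0$. There are constants $\epsilon_*>0$ and $c_*>0$, depending only on these five numbers, with the following property. Let a family of parameter-sphere ensembles (with the given $t,\delta,C_G$; the dimensions $M$ and $d$, the set $X$ and all other data may vary within the family) satisfy: 1. (Concentration.) For each member, either $\Theta$ has full measure in $S^{M-1}$, or $(\Theta,\|\cdot\|_2,\mu_\Theta)$ has Lévy concentration with constant $c_{\mathrm{par}}$: for all $L,\tau>0$ and every $L$-Lipschitz $f:\Theta\to\mathbb R$, $$\Pr_{\theta\sim\mu_\Theta}\bigl(|f(\theta)-\mathbb E_{\mu_\Theta}f|\ge\tau\bigr)\le2\exp\bigl(-c_{\mathrm{par}}M\tau^2/L^2\bigr).$$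 2. (Porter–Thomas mean assumption.) For each member, $\mathbb E_{\mathcal L\sim\mu_{\mathcal L}}\,d_{\mathrm{TV}}(P_{\mathcal L},Q)\in[m_0-\epsilon_{\mathrm{mean}},\,m_0+\epsilon_{\mathrm{mean}}]$, where $Q$ is the ensemble average of that member and the errors $\epsilon_{\mathrm{mean}}$ of the members tend to $0$ as $M\to\infty$. Then there is an $M_0$ such that for every member of the family with $M\ge M_0$ and every $D\in\mathcal D_X$, $$\Pr_{\mathcal L\sim\mu_{\mathcal L}}\bigl[d_{\mathrm{TV}}(P_{\mathcal L},D)\ge\epsilon_*\bigr]\ \ge\ 1-2\exp(-c_*M).$$ -/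

import Mathlib

open MeasureTheory Filter Topology
open scoped ENNReal NNReal ComplexOrder

noncomputable section

namespace RandomLindbladian

/-- Operators on the Hilbert space `ℂ^d`. -/
abbrev Op (d : ℕ) : Type := Matrix (Fin d) (Fin d) ℂ

/-- Superoperators: linear maps on the operators of `ℂ^d`. -/
abbrev SuperOp (d : ℕ) : Type := Op d →ₗ[ℂ] Op d

/-- The trace norm `‖A‖₁ = Tr √(A† A)`, i.e. the sum of the singular values of `A`
(the square roots of the eigenvalues of `A† A`). -/
def traceNorm {d : ℕ} (A : Op d) : ℝ :=
  ∑ i, Real.sqrt ((Matrix.isHermitian_conjTranspose_mul_self A).eigenvalues i)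

/-- The induced norm `‖T‖_{1→1} = sup_{X ≠ 0} ‖T X‖₁ / ‖X‖₁`, as an extended
nonnegative real. -/
def oneToOneNorm {d : ℕ} (T : SuperOp d) : ℝ≥0∞ :=
  ⨆ (A : Op d) (_ : A ≠ 0), ENNReal.ofReal (traceNorm (T A) / traceNorm A)

/-- The ampliation `T ⊗ id_k`, acting on operators of `ℂ^d ⊗ ℂ^k`: it applies `T` to each
of the `k × k` blocks. -/
def ampliation {d : ℕ} (T : SuperOp d) (k : ℕ)
    (A : Matrix (Fin d × Fin k) (Fin d × Fin k) ℂ) :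
    Matrix (Fin d × Fin k) (Fin d × Fin k) ℂ :=
  Matrix.of fun p q => T (Matrix.of fun i j => A (i, p.2) (j, q.2)) p.1 q.1

/-- Complete positivity: every ampliation maps positive semidefinite operators to positive
semidefinite operators. -/
def IsCompletelyPositive {d : ℕ} (T : SuperOp d) : Prop :=
  ∀ (k : ℕ) (A : Matrix (Fin d × Fin k) (Fin d × Fin k) ℂ),
    A.PosSemidef → (ampliation T k A).PosSemidef

/-- Completely positive and trace-preserving maps. -/
def IsCPTP {d : ℕ} (T : SuperOp d) : Prop :=
  IsCompletelyPositive T ∧ ∀ A : Op d, (T A).trace = A.trace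

/-- The superoperator `e^{tL}`. The exponential is taken of the matrix representing `L` in the
standard basis of matrix units. -/
def evolve {d : ℕ} (L : SuperOp d) (t : ℝ) : SuperOp d :=
  (LinearMap.toMatrixAlgEquiv (Matrix.stdBasis ℂ (Fin d) (Fin d))).symm
    (NormedSpace.exp
      ((t : ℂ) • LinearMap.toMatrixAlgEquiv (Matrix.stdBasis ℂ (Fin d) (Fin d)) L))

/-- GKSL generators (Lindbladians): `e^{tL}`, `t ≥ 0`, is a semigroup of CPTP maps. (That `L`
preserves Hermiticity and annihilates the trace follows by differentiation at `t = 0`.) -/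
def IsGKSL {d : ℕ} (L : SuperOp d) : Prop :=
  ∀ t : ℝ, 0 ≤ t → IsCPTP (evolve L t)

/-- The parameter sphere `S^{M-1}` with its Euclidean (chordal) metric. -/
abbrev ParamSphere (M : ℕ) : Type := Metric.sphere (0 : EuclideanSpace ℝ (Fin M)) 1

/-- The rotation-invariant surface measure on the parameter sphere (not normalized). -/
def surfaceMeasure (M : ℕ) : Measure (ParamSphere M) :=
  (volume : Measure (EuclideanSpace ℝ (Fin M))).toSphere

/-- The normalized restriction `μ_Θ` of the surface measure to `Θ`. -/
def paramMeasure {M : ℕ} (Θ : Set (ParamSphere M)) : Measure (ParamSphere M) :=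
  ProbabilityTheory.cond (surfaceMeasure M) Θ

/-- Sub-Gaussian (Lévy) concentration of the metric probability space `(Θ, ‖·‖₂, μ_Θ)` with
constant `c`: every `L`-Lipschitz function on `Θ` satisfies
`μ_Θ(|f - 𝔼 f| ≥ τ) ≤ 2 exp(-c M τ² / L²)`. -/
def LevyConcentration {M : ℕ} (c : ℝ) (Θ : Set (ParamSphere M)) : Prop :=
  ∀ (L : ℝ≥0) (f : ParamSphere M → ℝ), 0 < L → LipschitzOnWith L f Θ →
    ∀ τ : ℝ, 0 < τ →
      (paramMeasure Θ).real {θ | τ ≤ |f θ - ∫ θ', f θ' ∂(paramMeasure Θ)|}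
        ≤ 2 * Real.exp (-(c * M * τ ^ 2 / (L : ℝ) ^ 2))

/-- Total variation distance on a finite set. -/
def tvDist {X : Type*} [Fintype X] (P Q : X → ℝ) : ℝ :=
  (1 / 2) * ∑ x, |P x - Q x|

/-- `L(θ) = L_ref + (δ / √M) ∑ⱼ θⱼ Gⱼ`. -/
def lindbladian {d M : ℕ} (δ : ℝ) (Lref : SuperOp d) (G : Fin M → SuperOp d)
    (θ : ParamSphere M) : SuperOp d :=
  Lref + ((δ / Real.sqrt M : ℝ) : ℂ) • ∑ j, (((θ : EuclideanSpace ℝ (Fin M)) j : ℝ) : ℂ) • G j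

/-- A parameter-sphere ensemble of Lindbladians on `ℂ^d` with perturbation strength `δ` and with
directions of `1→1` norm at most `C_G`, together with a measurement interface: an input state
and a POVM with outcomes in the finite set `X`. -/
structure SphereEnsemble (d M : ℕ) (X : Type*) [Fintype X] (δ C_G : ℝ) where
  /-- the reference Lindbladian -/
  Lref : SuperOp d
  /-- the perturbation directions -/
  G : Fin M → SuperOp d
  /-- the admissible parameters -/
  Θ : Set (ParamSphere M)
  /-- the input state -/
  ρin : Op d
  /-- the POVM -/
  povm : X → Op d
  isGKSL_Lref : IsGKSL Lref
  norm_G_le : ∀ j, oneToOneNorm (G j) ≤ ENNReal.ofReal C_G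
  measurableSet_Θ : MeasurableSet Θ
  measure_Θ_ne_zero : surfaceMeasure M Θ ≠ 0
  isGKSL_of_mem : ∀ θ ∈ Θ, IsGKSL (lindbladian δ Lref G θ)
  posSemidef_ρin : ρin.PosSemidef
  trace_ρin : ρin.trace = 1
  posSemidef_povm : ∀ x, (povm x).PosSemidef
  sum_povm : ∑ x, povm x = 1

namespace SphereEnsemble

variable {d M : ℕ} {X : Type*} [Fintype X] {δ C_G : ℝ}

/-- The output distribution `P_L(x) = Tr(M_x e^{tL}(ρ_in))` of a Lindbladian `L`. -/
def output (E : SphereEnsemble d M X δ C_G) (t : ℝ) (L : SuperOp d) (x : X) : ℝ :=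
  (E.povm x * evolve L t E.ρin).trace.re

/-- The output distribution `P_{L(θ)}`; for `θ ∼ μ_Θ`, this is the output distribution of a
random Lindbladian `L ∼ μ_L` of the ensemble. -/
def outputAt (E : SphereEnsemble d M X δ C_G) (t : ℝ) (θ : ParamSphere M) : X → ℝ :=
  E.output t (lindbladian δ E.Lref E.G θ)

/-- The ensemble-average distribution `Q(x) = 𝔼_{L ∼ μ_L} P_L(x)`. -/
def meanOutput (E : SphereEnsemble d M X δ C_G) (t : ℝ) (x : X) : ℝ :=
  ∫ θ, E.outputAt t θ x ∂(paramMeasure E.Θ)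

/-- The mean `𝔼_{θ ∼ μ_Θ} d_TV(P_{L(θ)}, Q)` of the distance to the ensemble average. -/
def meanTV (E : SphereEnsemble d M X δ C_G) (t : ℝ) : ℝ :=
  ∫ θ, tvDist (E.outputAt t θ) (E.meanOutput t) ∂(paramMeasure E.Θ)

/-- The probability `Pr_{L ∼ μ_L}[p(P_L)]` that the output distribution has the property `p`. -/
def prob (E : SphereEnsemble d M X δ C_G) (t : ℝ) (p : (X → ℝ) → Prop) : ℝ :=
  (paramMeasure E.Θ).real {θ | p (E.outputAt t θ)}

end SphereEnsemble

end RandomLindbladian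

end

/-! The distance from `P_{L(θ)}` to a fixed `D` is a Lipschitz function on `Θ` whose constant `t δ
C_G` does not depend on `M`, `d` or `X`, so it concentrates near its mean. That mean is bounded
below uniformly in `D`: by convexity `Q` is no further from `D` than the outputs are on average, so
`𝔼 d(P, Q) ≤ 2 𝔼 d(P, D)`, and the Porter–Thomas assumption gives `𝔼 d(P, D) ≥ m₀ / 4` for large
`M`.

The Lipschitz bound comes from Duhamel's formula. Signs of the output differences turn the total
variation into a trace against one Hermitian contraction, which the Heisenberg dual of a channel
preserves. Trace-norm duality bounds each direction by `C_G`, and Cauchy–Schwarz over the directions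
cancels `1 / √M`.

Lévy concentration finishes directly. For `Θ` of full measure, a two-set inequality on the sphere is
proved from Prékopa–Leindler, applied to the cones over two separated sets. The sets `{d < ε}` and
`{d ≥ 2ε}` are separated, and the second has mass at least `2ε` because `d ≤ 1`, so the first is
exponentially small. -/

namespace RandomLindbladian

/-! ### The Prékopa–Leindler inequality for midpoints -/

section PrekopaLeindler

/-- The one-dimensional Brunn–Minkowski inequality for midpoints of compact sets. -/
theorem volume_add_le_of_isCompact {A B C : Set ℝ} (hA : IsCompact A) (hB : IsCompact B)
    (hA0 : A.Nonempty) (hB0 : B.Nonempty)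
    (h : ∀ a ∈ A, ∀ b ∈ B, (1 / 2 : ℝ) * (a + b) ∈ C) :
    volume A + volume B ≤ 2 * volume C := by
  obtain ⟨a, ha, ha'⟩ := hA.exists_isGreatest hA0
  obtain ⟨b, hb, hb'⟩ := hB.exists_isLeast hB0
  have hpre : ∀ (c : ℝ) (S : Set ℝ),
      volume ((fun x : ℝ => (1 / 2 : ℝ) * (x + c)) ⁻¹' S) = 2 * volume S := by
    intro c S
    have : (fun x : ℝ => (1 / 2 : ℝ) * (x + c)) ⁻¹' S
        = (fun x => x + c) ⁻¹' ((fun x => (1 / 2 : ℝ) * x) ⁻¹' S) := rfl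
    rw [this, measure_preimage_add_right, Real.volume_preimage_mul_left (by norm_num)]
    norm_num
  -- With `a = max A` and `b = min B`, the sets `(A + b) / 2` and `(a + B) / 2` lie in `C` on
  -- opposite sides of `p` and meet at most in `p`.
  set p : ℝ := (1 / 2 : ℝ) * (a + b) with hp
  have h1 : volume A ≤ 2 * volume (C ∩ Set.Iic p) := by
    rw [← hpre b]
    refine measure_mono fun x hx => ⟨h x hx b hb, ?_⟩
    have := ha' hx
    simp only [Set.mem_Iic, hp]
    linarith
  have h2 : volume B ≤ 2 * volume (C \ Set.Iic p) := by
    rw [← hpre a, ← measure_sdiff_null (s := B) (measure_singleton b)]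
    refine measure_mono fun x hx => ⟨?_, ?_⟩
    · simpa only [add_comm] using h a ha x hx.1
    · have := lt_of_le_of_ne (hb' hx.1) (Ne.symm hx.2)
      simp only [Set.mem_Iic, hp, not_le]
      linarith
  calc volume A + volume B
      ≤ 2 * volume (C ∩ Set.Iic p) + 2 * volume (C \ Set.Iic p) := add_le_add h1 h2
    _ = 2 * volume C := by rw [← mul_add, measure_inter_add_sdiff _ measurableSet_Iic]

/-- The one-dimensional Brunn–Minkowski inequality for midpoints. -/
theorem volume_add_le {A B C : Set ℝ} (hA : MeasurableSet A) (hB : MeasurableSet B)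
    (hA0 : A.Nonempty) (hB0 : B.Nonempty)
    (h : ∀ a ∈ A, ∀ b ∈ B, (1 / 2 : ℝ) * (a + b) ∈ C) :
    volume A + volume B ≤ 2 * volume C := by
  obtain ⟨a, ha⟩ := hA0
  obtain ⟨b, hb⟩ := hB0
  rw [hA.measure_eq_iSup_isCompact, hB.measure_eq_iSup_isCompact]
  simp only [iSup_and']
  refine ENNReal.biSup_add_biSup_le' ⟨∅, by simp⟩ ⟨∅, by simp⟩ fun K hK K' hK' => ?_
  -- The approximating compact sets may be empty; adding a point of `A` or `B` restores
  -- nonemptiness.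
  calc volume K + volume K' ≤ volume (insert a K) + volume (insert b K') :=
        add_le_add (measure_mono (Set.subset_insert _ _)) (measure_mono (Set.subset_insert _ _))
    _ ≤ 2 * volume C := by
        refine volume_add_le_of_isCompact (hK.2.insert a) (hK'.2.insert b)
          (Set.insert_nonempty _ _) (Set.insert_nonempty _ _) fun x hx y hy => h x ?_ y ?_
        · exact Set.insert_subset ha hK.1 hx
        · exact Set.insert_subset hb hK'.1 hy

/-- The Prékopa–Leindler inequality on the line for functions with supremum `1`. -/
theorem lintegral_add_le_of_sup_eq_one {f g h : ℝ → ℝ} (hf : Measurable f) (hg : Measurable g)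
    (hh : Measurable h) (hf0 : 0 ≤ f) (hg0 : 0 ≤ g) (hh0 : 0 ≤ h)
    (hf1 : ∀ x, f x ≤ 1) (hg1 : ∀ x, g x ≤ 1)
    (hfs : ∀ l < 1, ∃ x, l < f x) (hgs : ∀ l < 1, ∃ x, l < g x)
    (H : ∀ x y, min (f x) (g y) ≤ h ((1 / 2 : ℝ) * (x + y))) :
    (∫⁻ x, ENNReal.ofReal (f x)) + ∫⁻ x, ENNReal.ofReal (g x)
      ≤ 2 * ∫⁻ x, ENNReal.ofReal (h x) := by
  rw [lintegral_eq_lintegral_meas_lt _ (.of_forall hf0) hf.aemeasurable,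
    lintegral_eq_lintegral_meas_lt _ (.of_forall hg0) hg.aemeasurable,
    lintegral_eq_lintegral_meas_lt _ (.of_forall hh0) hh.aemeasurable]
  have hm : ∀ u : ℝ → ℝ, Measurable fun l : ℝ => volume {x | l < u x} := fun u =>
    Antitone.measurable fun l l' hl => measure_mono fun x hx => lt_of_le_of_lt hl hx
  rw [← lintegral_add_left (hm f), ← lintegral_const_mul _ (hm h)]
  refine lintegral_mono fun l => ?_
  -- Equal suprema make the superlevel sets of `f` and `g` nonempty for the same levels, as
  -- Brunn–Minkowski requires.
  rcases lt_or_ge l 1 with hl | hl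
  · refine volume_add_le (measurableSet_lt measurable_const hf)
      (measurableSet_lt measurable_const hg) (hfs l hl) (hgs l hl) fun a ha b hb => ?_
    exact lt_of_lt_of_le (lt_min ha hb) (H a b)
  · have h1 : {x | l < f x} = ∅ := by
      ext x; simpa using (hf1 x).trans hl
    have h2 : {x | l < g x} = ∅ := by
      ext x; simpa using (hg1 x).trans hl
    simp [h1, h2]

/-- AM–GM: it turns the additive inequality for normalized functions into the multiplicative one. -/
theorem mul_le_sq_of_add_le {x y z : ℝ≥0∞} (h : x + y ≤ 2 * z) : x * y ≤ z ^ 2 := by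
  rcases eq_or_ne z ⊤ with rfl | hz
  · simp
  have hs : x + y ≠ ⊤ := ne_top_of_le_ne_top (ENNReal.mul_ne_top (by simp) hz) h
  lift z to ℝ≥0 using hz
  lift x to ℝ≥0 using (ENNReal.add_ne_top.1 hs).1
  lift y to ℝ≥0 using (ENNReal.add_ne_top.1 hs).2
  norm_cast at h ⊢
  rw [← NNReal.coe_le_coe] at h ⊢
  push_cast at h ⊢
  have hx := x.2
  have hy := y.2
  nlinarith [sq_nonneg ((x : ℝ) - y), x.coe_nonneg, y.coe_nonneg, z.coe_nonneg]

/-- The Prékopa–Leindler inequality on the line for bounded functions. -/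
theorem prekopa_leindler_real_of_bounded {f g h : ℝ → ℝ≥0∞} (hf : Measurable f)
    (hg : Measurable g) (hh : Measurable h) (hfb : ⨆ x, f x ≠ ⊤) (hgb : ⨆ x, g x ≠ ⊤)
    (H : ∀ x y, f x * g y ≤ h ((1 / 2 : ℝ) • (x + y)) ^ 2) :
    (∫⁻ x, f x) * ∫⁻ x, g x ≤ (∫⁻ x, h x) ^ 2 := by
  set a := ⨆ x, f x with ha
  set b := ⨆ x, g x with hb
  rcases eq_or_ne a 0 with ha0 | ha0
  · have : ∀ x, f x = 0 := fun x => le_antisymm (ha0 ▸ le_iSup f x) zero_le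
    simp [this]
  rcases eq_or_ne b 0 with hb0 | hb0
  · have : ∀ x, g x = 0 := fun x => le_antisymm (hb0 ▸ le_iSup g x) zero_le
    simp [this]
  -- Dividing `f`, `g`, `h` by `a`, `b` and their geometric mean `c` preserves the hypothesis and
  -- makes the first two suprema `1`.
  obtain ⟨c, hc⟩ : ∃ c : ℝ≥0∞, c ^ 2 = a * b :=
    ⟨(a * b) ^ (1 / 2 : ℝ), by rw [← ENNReal.rpow_natCast, ← ENNReal.rpow_mul]; norm_num⟩
  have hab0 : a * b ≠ 0 := mul_ne_zero ha0 hb0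
  have habt : a * b ≠ ⊤ := ENNReal.mul_ne_top hfb hgb
  have hc0 : c ≠ 0 := by rintro rfl; simp at hc; tauto
  have hfa : ∀ x, f x * a⁻¹ ≤ 1 := fun x => by
    rw [← ENNReal.mul_inv_cancel ha0 hfb]; gcongr; exact le_iSup f x
  have hgb' : ∀ x, g x * b⁻¹ ≤ 1 := fun x => by
    rw [← ENNReal.mul_inv_cancel hb0 hgb]; gcongr; exact le_iSup g x
  have hsup : ∀ (u : ℝ → ℝ≥0∞) (s : ℝ≥0∞), s = ⨆ x, u x → s ≠ 0 → s ≠ ⊤ →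
      (∀ x, u x * s⁻¹ ≤ 1) → ∀ l < 1, ∃ x, l < (u x * s⁻¹).toReal := by
    intro u s hs hs0 hst hu l hl
    have h1 : ENNReal.ofReal (max l 0) < ⨆ x, u x * s⁻¹ := by
      rw [← ENNReal.iSup_mul, ← hs, ENNReal.mul_inv_cancel hs0 hst, ENNReal.ofReal_lt_one]
      exact max_lt hl one_pos
    obtain ⟨x, hx⟩ := lt_iSup_iff.1 h1
    refine ⟨x, (le_max_left _ _).trans_lt ((ENNReal.ofReal_lt_iff_lt_toReal (le_max_right _ _)
      (ne_top_of_le_ne_top ENNReal.one_ne_top (hu x))).1 hx)⟩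
  -- Truncation at `1` makes `h` finite and costs nothing, since the normalized `f` and `g` are at
  -- most `1`.
  have hmin : ∀ x, min (h x * c⁻¹) 1 ≠ ⊤ := fun x =>
    ne_top_of_le_ne_top ENNReal.one_ne_top (min_le_right _ _)
  have key := lintegral_add_le_of_sup_eq_one (f := fun x => (f x * a⁻¹).toReal)
    (g := fun x => (g x * b⁻¹).toReal) (h := fun x => (min (h x * c⁻¹) 1).toReal)
    (hf.mul_const _).ennreal_toReal (hg.mul_const _).ennreal_toReal
    ((hh.mul_const _).min measurable_const).ennreal_toReal
    (fun _ => ENNReal.toReal_nonneg) (fun _ => ENNReal.toReal_nonneg)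
    (fun _ => ENNReal.toReal_nonneg)
    (fun x => ENNReal.toReal_le_of_le_ofReal zero_le_one (by simpa using hfa x))
    (fun x => ENNReal.toReal_le_of_le_ofReal zero_le_one (by simpa using hgb' x))
    (hsup f a ha ha0 hfb hfa) (hsup g b hb hb0 hgb hgb') (by
      intro x y
      rw [← ENNReal.toReal_min (ne_top_of_le_ne_top ENNReal.one_ne_top (hfa x))
        (ne_top_of_le_ne_top ENNReal.one_ne_top (hgb' y))]
      refine ENNReal.toReal_mono (hmin _) (le_min ?_ ((min_le_left _ _).trans (hfa x)))
      refine (ENNReal.pow_le_pow_left_iff two_ne_zero).1 ?_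
      calc (min (f x * a⁻¹) (g y * b⁻¹)) ^ 2 ≤ (f x * a⁻¹) * (g y * b⁻¹) := by
            rw [sq]; exact mul_le_mul' (min_le_left _ _) (min_le_right _ _)
        _ = (f x * g y) * (a * b)⁻¹ := by
            rw [ENNReal.mul_inv (.inl ha0) (.inl hfb)]; ring
        _ ≤ h ((1 / 2 : ℝ) * (x + y)) ^ 2 * (a * b)⁻¹ := by gcongr; exact H x y
        _ = _ := by rw [← hc, mul_pow, ENNReal.inv_pow])
  simp only [ENNReal.ofReal_toReal (ne_top_of_le_ne_top ENNReal.one_ne_top (hfa _)),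
    ENNReal.ofReal_toReal (ne_top_of_le_ne_top ENNReal.one_ne_top (hgb' _)),
    ENNReal.ofReal_toReal (hmin _)] at key
  rw [lintegral_mul_const _ hf, lintegral_mul_const _ hg] at key
  have key2 := mul_le_sq_of_add_le (key.trans (mul_le_mul_right
    (lintegral_mono fun x => min_le_left (h x * c⁻¹) 1) 2))
  rw [lintegral_mul_const _ hh, mul_pow, ← ENNReal.inv_pow, hc] at key2
  rw [← ENNReal.mul_le_mul_iff_left (ENNReal.inv_ne_zero.2 habt) (ENNReal.inv_ne_top.2 hab0)]
  refine le_trans (le_of_eq ?_) key2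
  rw [ENNReal.mul_inv (.inl ha0) (.inl hfb)]; ring

/-- The property that `μ` satisfies the Prékopa–Leindler inequality for midpoints. -/
def PrekopaLeindler {E : Type*} [AddCommGroup E] [Module ℝ E] [MeasurableSpace E]
    (μ : Measure E) : Prop :=
  ∀ f g h : E → ℝ≥0∞, Measurable f → Measurable g → Measurable h →
    (∀ x y, f x * g y ≤ h ((1 / 2 : ℝ) • (x + y)) ^ 2) →
    (∫⁻ x, f x ∂μ) * ∫⁻ x, g x ∂μ ≤ (∫⁻ x, h x ∂μ) ^ 2

theorem lintegral_eq_iSup_min {f : ℝ → ℝ≥0∞} (hf : Measurable f) :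
    ∫⁻ x, f x = ⨆ n : ℕ, ∫⁻ x, min (f x) n := by
  rw [← lintegral_iSup (fun n => hf.min measurable_const)
    (fun n m hnm x => min_le_min_left _ (by exact_mod_cast hnm))]
  refine lintegral_congr fun x => ?_
  rw [← inf_iSup_eq (f x), ENNReal.iSup_natCast, inf_top_eq]

theorem prekopaLeindler_real : PrekopaLeindler (volume : Measure ℝ) := by
  intro f g h hf hg hh H
  rw [lintegral_eq_iSup_min hf, lintegral_eq_iSup_min hg]
  rw [ENNReal.iSup_mul]
  refine iSup_le fun n => ?_
  rw [ENNReal.mul_iSup]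
  refine iSup_le fun m => prekopa_leindler_real_of_bounded (hf.min measurable_const)
    (hg.min measurable_const) hh ?_ ?_ fun x y => ?_
  · exact ne_top_of_le_ne_top (ENNReal.natCast_ne_top n) (iSup_le fun x => min_le_right _ _)
  · exact ne_top_of_le_ne_top (ENNReal.natCast_ne_top m) (iSup_le fun x => min_le_right _ _)
  · exact (mul_le_mul' (min_le_left _ _) (min_le_left _ _)).trans (H x y)

variable {E F : Type*} [AddCommGroup E] [Module ℝ E] [MeasurableSpace E]
  [AddCommGroup F] [Module ℝ F] [MeasurableSpace F]

/-- The inequality for `ν` on fibres is exactly the hypothesis for `μ` on the fibre integrals. -/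
theorem PrekopaLeindler.prod {μ : Measure E} {ν : Measure F} [SFinite ν]
    (hμ : PrekopaLeindler μ) (hν : PrekopaLeindler ν) : PrekopaLeindler (μ.prod ν) := by
  intro f g h hf hg hh H
  rw [lintegral_prod _ hf.aemeasurable, lintegral_prod _ hg.aemeasurable,
    lintegral_prod _ hh.aemeasurable]
  refine hμ _ _ _ hf.lintegral_prod_right' hg.lintegral_prod_right' hh.lintegral_prod_right'
    fun x y => hν _ _ _ (hf.comp measurable_prodMk_left) (hg.comp measurable_prodMk_left)
      (hh.comp measurable_prodMk_left) fun u v => H (x, u) (y, v)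

theorem PrekopaLeindler.of_measurePreserving {μ : Measure E} {ν : Measure F} (e : E → F)
    (he : MeasurePreserving e μ ν) (hadd : ∀ x y, e (x + y) = e x + e y)
    (hsmul : ∀ (c : ℝ) x, e (c • x) = c • e x)
    (hμ : PrekopaLeindler μ) : PrekopaLeindler ν := by
  intro f g h hf hg hh H
  rw [← he.lintegral_comp hf, ← he.lintegral_comp hg, ← he.lintegral_comp hh]
  refine hμ _ _ _ (hf.comp he.measurable) (hg.comp he.measurable) (hh.comp he.measurable)
    fun x y => ?_
  rw [hsmul, hadd]
  exact H _ _

theorem prekopaLeindler_pi (n : ℕ) : PrekopaLeindler (volume : Measure (Fin n → ℝ)) := by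
  induction n with
  | zero =>
    intro f g h hf hg hh H
    have hv : (volume : Measure (Fin 0 → ℝ)) = Measure.dirac default := by
      rw [volume_pi, Measure.pi_of_empty _ default]
    rw [hv, lintegral_dirac, lintegral_dirac, lintegral_dirac]
    convert H default default
  | succ n ih =>
    refine PrekopaLeindler.of_measurePreserving _
      (volume_preserving_piFinSuccAbove (fun _ : Fin (n + 1) => ℝ) 0).symm ?_ ?_
      (prekopaLeindler_real.prod ih)
    · intro x y
      ext i
      refine Fin.cases ?_ (fun j => ?_) i <;> simp [MeasurableEquiv.piFinSuccAbove]
    · intro c x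
      ext i
      refine Fin.cases ?_ (fun j => ?_) i <;> simp [MeasurableEquiv.piFinSuccAbove]

theorem prekopaLeindler_euclideanSpace (n : ℕ) :
    PrekopaLeindler (volume : Measure (EuclideanSpace ℝ (Fin n))) :=
  PrekopaLeindler.of_measurePreserving _ (PiLp.volume_preserving_toLp (Fin n))
    (fun _ _ => rfl) (fun _ _ => rfl) (prekopaLeindler_pi n)

end PrekopaLeindler
-- Concentration of measure on the sphere
section SphereConcentration
open scoped Pointwise

/-- At `a = b = 1` this is the parallelogram law. For smaller radii the error `r² (1 - a b) ≤ 1 - a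
b` is absorbed by `4 - (a + b)²`; this uses `r ≤ 1`. -/
theorem norm_midpoint_le_of_le_dist {E : Type*} [NormedAddCommGroup E] [InnerProductSpace ℝ E]
    {x y : E} (hx : ‖x‖ = 1) (hy : ‖y‖ = 1) {r : ℝ} (hr : 0 ≤ r) (hr1 : r ≤ 1)
    (hxy : r ≤ dist x y) {a b : ℝ} (ha : a ∈ Set.Ioo (0 : ℝ) 1) (hb : b ∈ Set.Ioo (0 : ℝ) 1) :
    ‖(1 / 2 : ℝ) • (a • x + b • y)‖ ^ 2 < 1 - r ^ 2 / 4 := by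
  have h1 : r ^ 2 ≤ 2 - 2 * inner ℝ x y := by
    have : ‖x - y‖ ^ 2 = 2 - 2 * inner ℝ x y := by
      rw [norm_sub_sq_real, hx, hy]; ring
    rw [← this, ← dist_eq_norm]
    exact pow_le_pow_left₀ hr hxy 2
  have h2 : ‖(1 / 2 : ℝ) • (a • x + b • y)‖ ^ 2
      = (a ^ 2 + b ^ 2 + 2 * (a * b) * inner ℝ x y) / 4 := by
    rw [norm_smul, mul_pow, norm_add_sq_real, norm_smul, norm_smul, real_inner_smul_left,
      real_inner_smul_right, hx, hy]
    simp only [Real.norm_eq_abs, mul_one, sq_abs]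
    ring
  rw [h2]
  obtain ⟨ha0, ha1⟩ := ha
  obtain ⟨hb0, hb1⟩ := hb
  have hab : a * b < 1 := by nlinarith
  have hab0 : 0 < a * b := by positivity
  have h3 : a * b * inner ℝ x y ≤ a * b * (1 - r ^ 2 / 2) := by
    gcongr; linarith
  have h4 : r ^ 2 * (1 - a * b) ≤ 1 * (1 - a * b) := by
    gcongr
    nlinarith
  nlinarith

/-- Two-set concentration of measure on the sphere. -/
theorem surfaceMeasure_mul_le {n : ℕ} {A B : Set (ParamSphere n)} (hA : MeasurableSet A)
    (hB : MeasurableSet B) {r : ℝ} (hr : 0 ≤ r) (hr1 : r ≤ 1)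
    (hAB : ∀ x ∈ A, ∀ y ∈ B, r ≤ dist x y) :
    (surfaceMeasure n).real A * (surfaceMeasure n).real B
      ≤ Real.exp (-(r ^ 2 / 4 * n)) * (surfaceMeasure n).real Set.univ ^ 2 := by
  rcases Nat.eq_zero_or_pos n with rfl | hn
  · have : surfaceMeasure 0 = 0 := (Measure.toSphere_eq_zero_iff_finrank _).2 (by simp)
    simp [this]
  have := Nonempty.intro (⟨0, hn⟩ : Fin n)
  let E := EuclideanSpace ℝ (Fin n)
  -- Surface measure is `n` times the volume of the cone, so it suffices to bound volumes.
  let cone : Set (ParamSphere n) → Set E := fun S => Set.Ioo (0 : ℝ) 1 • ((↑) '' S : Set E)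
  have hcone : ∀ S, MeasurableSet S → MeasurableSet (cone S) := by
    intro S hS
    have h : cone S = (↑) '' (homeomorphUnitSphereProd E ⁻¹' S ×ˢ Set.Iio ⟨1, Set.mem_Ioi.2 one_pos⟩) := by
      simp only [cone]
      rw [← Set.image2_smul, Set.image2_image_right, ← Homeomorph.image_symm, Set.image_image,
        ← Set.image_subtype_val_Ioi_Iio ⟨1, Set.mem_Ioi.2 one_pos⟩, Set.image2_image_left, Set.image2_swap,
        ← Set.image_prod]
      rfl
    rw [h]
    exact ((MeasurableEmbedding.subtype_coe (measurableSet_singleton _).compl).measurableSet_image).2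
      ((homeomorphUnitSphereProd E).measurable (hS.prod measurableSet_Iio))
  set s : ℝ := Real.sqrt (1 - r ^ 2 / 4) with hs
  have hs0 : 0 ≤ s := Real.sqrt_nonneg _
  have hs2 : s ^ 2 = 1 - r ^ 2 / 4 := Real.sq_sqrt (by nlinarith)
  -- Midpoints of the two cones fall in a ball of radius `s < 1` when `r > 0`; the gain is `s ^ (2
  -- n)`.
  have key : volume (cone A) * volume (cone B) ≤ volume (Metric.ball (0 : E) s) ^ 2 := by
    have := prekopaLeindler_euclideanSpace n ((cone A).indicator 1) ((cone B).indicator 1)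
      ((Metric.ball (0 : E) s).indicator 1)
      (measurable_one.indicator (hcone A hA)) (measurable_one.indicator (hcone B hB))
      (measurable_one.indicator Metric.isOpen_ball.measurableSet) (by
        intro x y
        by_cases hx : x ∈ cone A
        · by_cases hy : y ∈ cone B
          · have hz : (1 / 2 : ℝ) • (x + y) ∈ Metric.ball (0 : E) s := by
              obtain ⟨a, ha, _, ⟨u, hu, rfl⟩, rfl⟩ := hx
              obtain ⟨b, hb, _, ⟨v, hv, rfl⟩, rfl⟩ := hy
              rw [mem_ball_zero_iff]
              refine lt_of_pow_lt_pow_left₀ 2 hs0 ?_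
              rw [hs2]
              exact norm_midpoint_le_of_le_dist (by simp) (by simp) hr hr1 (hAB u hu v hv) ha hb
            rw [Set.indicator_of_mem hx, Set.indicator_of_mem hy, Set.indicator_of_mem hz]
            simp
          · simp [hy]
        · simp [hx])
    rwa [lintegral_indicator_one (hcone A hA), lintegral_indicator_one (hcone B hB),
      lintegral_indicator_one Metric.isOpen_ball.measurableSet] at this
  have hball : volume (Metric.ball (0 : E) s)
      = ENNReal.ofReal (s ^ n) * volume (Metric.ball (0 : E) 1) := by
    rw [Measure.addHaar_ball _ _ hs0]
    simp [E]
  have hreal : ∀ S, MeasurableSet S → (surfaceMeasure n).real S = n * volume.real (cone S) := by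
    intro S hS
    simp [surfaceMeasure, measureReal_def, Measure.toSphere_apply' _ hS, cone]
  have huniv : (surfaceMeasure n).real Set.univ = n * volume.real (Metric.ball (0 : E) 1) := by
    simp [surfaceMeasure, Measure.toSphere_real_apply_univ, E]
  have key2 : volume.real (cone A) * volume.real (cone B)
      ≤ (s ^ n * volume.real (Metric.ball (0 : E) 1)) ^ 2 := by
    rw [hball] at key
    have h := ENNReal.toReal_mono (by
      exact ENNReal.pow_ne_top (ENNReal.mul_ne_top ENNReal.ofReal_ne_top measure_ball_lt_top.ne)) key
    simpa [ENNReal.toReal_mul, ENNReal.toReal_pow, ENNReal.toReal_ofReal (pow_nonneg hs0 n),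
      measureReal_def] using h
  have hexp : (s ^ n) ^ 2 ≤ Real.exp (-(r ^ 2 / 4 * n)) := by
    rw [← pow_mul, mul_comm n 2, pow_mul, hs2]
    calc (1 - r ^ 2 / 4) ^ n ≤ Real.exp (-(r ^ 2 / 4)) ^ n := by
          refine pow_le_pow_left₀ (by nlinarith) ?_ n
          have := Real.add_one_le_exp (-(r ^ 2 / 4))
          linarith
      _ = _ := by rw [← Real.exp_nat_mul]; congr 1; ring
  rw [hreal A hA, hreal B hB, huniv]
  calc (n : ℝ) * volume.real (cone A) * (n * volume.real (cone B))
      = n ^ 2 * (volume.real (cone A) * volume.real (cone B)) := by ring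
    _ ≤ n ^ 2 * (s ^ n * volume.real (Metric.ball (0 : E) 1)) ^ 2 := by gcongr
    _ = (s ^ n) ^ 2 * (n * volume.real (Metric.ball (0 : E) 1)) ^ 2 := by ring
    _ ≤ _ := by gcongr

end SphereConcentration
-- Trace norm and Hermitian contractions
section TraceNorm
open Matrix

variable {d : ℕ}

/-- A Hermitian contraction, given by the operator inequalities `-1 ≤ B ≤ 1`. -/
def IsHermitianContraction (B : Op d) : Prop :=
  (1 - B).PosSemidef ∧ (1 + B).PosSemidef

/-- `2 (1 - B²)` is the sum of the congruences `(1 + B)(1 - B)(1 + B)` and `(1 - B)(1 + B)(1 - B)`.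
-/
theorem IsHermitianContraction.one_sub_sq {B : Op d} (h : IsHermitianContraction B) :
    (1 - B * B).PosSemidef := by
  have h1 := h.1.conjTranspose_mul_mul_same (1 + B)
  have h2 := h.2.conjTranspose_mul_mul_same (1 - B)
  rw [h.2.1.eq] at h1
  rw [h.1.1.eq] at h2
  have h3 := (h1.add h2).smul (show (0 : ℝ) ≤ 1 / 2 by norm_num)
  convert h3 using 1
  have : (1 + B) * (1 - B) * (1 + B) + (1 - B) * (1 + B) * (1 - B) = (2 : ℝ) • (1 - B * B) := by
    rw [two_smul]; noncomm_ring
  rw [this, smul_smul]; norm_num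

theorem IsHermitianContraction.isHermitian {B : Op d} (h : IsHermitianContraction B) :
    B.IsHermitian := by
  have := h.2.1.sub (isHermitian_one (n := Fin d) (α := ℂ))
  simpa using this

theorem norm_sq_toLp (v : Fin d → ℂ) : ((‖WithLp.toLp 2 v‖ ^ 2 : ℝ) : ℂ) = star v ⬝ᵥ v := by
  rw [EuclideanSpace.norm_sq_eq]
  simp [dotProduct, Complex.conj_mul']

theorem IsHermitianContraction.norm_mulVec_le {B : Op d} (h : IsHermitianContraction B)
    (v : Fin d → ℂ) : ‖WithLp.toLp 2 (B *ᵥ v)‖ ≤ ‖WithLp.toLp 2 v‖ := by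
  have h1 := h.one_sub_sq.dotProduct_mulVec_nonneg v
  rw [sub_mulVec, one_mulVec, dotProduct_sub, sub_nonneg, ← mulVec_mulVec, dotProduct_mulVec] at h1
  have h2 : star v ᵥ* B = star (B *ᵥ v) := by rw [star_mulVec, h.isHermitian.eq]
  rw [h2, ← norm_sq_toLp, ← norm_sq_toLp] at h1
  refine le_of_sq_le_sq ?_ (norm_nonneg _)
  exact_mod_cast h1

theorem norm_dotProduct_le (v w : Fin d → ℂ) :
    ‖star v ⬝ᵥ w‖ ≤ ‖WithLp.toLp 2 v‖ * ‖WithLp.toLp 2 w‖ := by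
  have := norm_inner_le_norm (𝕜 := ℂ) (WithLp.toLp 2 v) (WithLp.toLp 2 w)
  rwa [EuclideanSpace.inner_toLp_toLp, dotProduct_comm] at this

/-- The trace computed in an orthonormal basis. -/
theorem trace_eq_sum_orthonormalBasis (b : OrthonormalBasis (Fin d) ℂ (EuclideanSpace ℂ (Fin d)))
    (A : Op d) : A.trace = ∑ i, star (b i).ofLp ⬝ᵥ (A *ᵥ (b i).ofLp) := by
  have h1 : LinearMap.trace ℂ _ (Matrix.toEuclideanLin A) = A.trace := by
    rw [Matrix.toEuclideanLin_eq_toLin_orthonormal,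
      LinearMap.trace_eq_matrix_trace ℂ (EuclideanSpace.basisFun (Fin d) ℂ).toBasis,
      LinearMap.toMatrix_toLin]
  rw [← h1, LinearMap.trace_eq_sum_inner _ b]
  refine Finset.sum_congr rfl fun i _ => ?_
  rw [EuclideanSpace.inner_eq_star_dotProduct, dotProduct_comm]
  rfl

theorem norm_mulVec_eigenvectorBasis (A : Op d) (i : Fin d) :
    ‖WithLp.toLp 2 (A *ᵥ ((isHermitian_conjTranspose_mul_self A).eigenvectorBasis i).ofLp)‖
      = Real.sqrt ((isHermitian_conjTranspose_mul_self A).eigenvalues i) := by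
  set hA := isHermitian_conjTranspose_mul_self A
  set v : Fin d → ℂ := (hA.eigenvectorBasis i).ofLp with hv
  have h1 : (Aᴴ * A) *ᵥ v = hA.eigenvalues i • v := hA.mulVec_eigenvectorBasis i
  have hv1 : ‖WithLp.toLp 2 v‖ = 1 := hA.eigenvectorBasis.orthonormal.1 i
  have h2 := norm_sq_toLp (A *ᵥ v)
  rw [star_mulVec, ← dotProduct_mulVec, mulVec_mulVec, h1, dotProduct_smul, ← norm_sq_toLp, hv1] at h2
  rw [← Real.sqrt_sq (norm_nonneg (WithLp.toLp 2 (A *ᵥ v)))]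
  congr 1
  rw [one_pow, Complex.ofReal_one, Complex.real_smul, mul_one] at h2
  exact_mod_cast h2

/-- In a basis `v i` of right singular vectors, each term is at most `‖A v i‖`, the corresponding
singular value, by Cauchy–Schwarz. -/
theorem norm_trace_mul_le {B : Op d} (hB : IsHermitianContraction B) (A : Op d) :
    ‖(B * A).trace‖ ≤ traceNorm A := by
  set hA := isHermitian_conjTranspose_mul_self A with hA'
  rw [trace_eq_sum_orthonormalBasis hA.eigenvectorBasis]
  refine (norm_sum_le _ _).trans (Finset.sum_le_sum fun i _ => ?_)
  refine (norm_dotProduct_le _ _).trans ?_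
  have h1 : ‖WithLp.toLp 2 (hA.eigenvectorBasis i).ofLp‖ = 1 :=
    hA.eigenvectorBasis.orthonormal.1 i
  rw [h1, one_mul, ← mulVec_mulVec, ← norm_mulVec_eigenvectorBasis]
  exact hB.norm_mulVec_le _

theorem traceNorm_eq_of_posSemidef {ρ : Op d} (hρ : ρ.PosSemidef) :
    (traceNorm ρ : ℂ) = ρ.trace := by
  set hA := isHermitian_conjTranspose_mul_self ρ with hA'
  rw [trace_eq_sum_orthonormalBasis hA.eigenvectorBasis, traceNorm]
  push_cast
  refine Finset.sum_congr rfl fun i _ => ?_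
  set v : Fin d → ℂ := (hA.eigenvectorBasis i).ofLp with hv
  set l : ℝ := Real.sqrt (hA.eigenvalues i) with hl
  have hv1 : ‖WithLp.toLp 2 v‖ = 1 := hA.eigenvectorBasis.orthonormal.1 i
  have h0 : ‖WithLp.toLp 2 (ρ *ᵥ v)‖ = l := norm_mulVec_eigenvectorBasis ρ i
  suffices h : ρ *ᵥ v = (l : ℂ) • v by
    rw [h, dotProduct_smul, ← norm_sq_toLp, hv1]; simp
  rcases eq_or_ne l 0 with h | h
  · rw [h] at h0 ⊢
    have := norm_eq_zero.1 h0
    rw [Complex.ofReal_zero, zero_smul]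
    simpa using this
  · have hl0 : 0 < l := lt_of_le_of_ne (Real.sqrt_nonneg _) (Ne.symm h)
    have h1 : (ρᴴ * ρ) *ᵥ v = hA.eigenvalues i • v := hA.mulVec_eigenvectorBasis i
    have h2 : hA.eigenvalues i = l ^ 2 :=
      (Real.sq_sqrt (eigenvalues_conjTranspose_mul_self_nonneg ρ i)).symm
    rw [h2, ← mulVec_mulVec] at h1
    have h1' : ρ *ᵥ ρ *ᵥ v = l ^ 2 • v := by simpa only [hρ.1.eq] using h1
    -- `(ρ + l)(ρ - l) v = 0`, and a positive `ρ` has no eigenvalue `-l < 0`, so the singular vector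
    -- `v` is an eigenvector.
    set w := ρ *ᵥ v - (l : ℂ) • v with hw
    have h3 : ρ *ᵥ w = -((l : ℂ) • w) := by
      rw [hw, mulVec_sub, h1', mulVec_smul]
      ext j
      simp
      ring
    have h4 := hρ.dotProduct_mulVec_nonneg w
    rw [h3, dotProduct_neg, dotProduct_smul, ← norm_sq_toLp, smul_eq_mul] at h4
    have h5 : 0 ≤ -(l * ‖WithLp.toLp 2 w‖ ^ 2) := by exact_mod_cast h4
    have h6 : ‖WithLp.toLp 2 w‖ ^ 2 = 0 := by
      have := sq_nonneg ‖WithLp.toLp 2 w‖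
      nlinarith
    have h7 : w = 0 := by simpa using h6
    exact sub_eq_zero.1 h7

end TraceNorm
-- Heisenberg duality and Duhamel's formula
section Evolution
open Matrix

variable {d : ℕ}

theorem trace_mul_vecMulVec_star (A : Op d) (v : Fin d → ℂ) :
    (A * vecMulVec v (star v)).trace = star v ⬝ᵥ (A *ᵥ v) := by
  rw [mul_vecMulVec, trace_vecMulVec, dotProduct_comm]

theorem posSemidef_of_trace_nonneg {A : Op d}
    (h : ∀ v : Fin d → ℂ, 0 ≤ (A * vecMulVec v (star v)).trace) : A.PosSemidef := by
  rw [← isPositive_toEuclideanLin_iff, LinearMap.isPositive_iff_complex]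
  intro x
  have h1 := h x.ofLp
  rw [trace_mul_vecMulVec_star] at h1
  have h2 : inner ℂ (A.toEuclideanLin x) x = star x.ofLp ⬝ᵥ (A *ᵥ x.ofLp) := by
    rw [← inner_conj_symm, EuclideanSpace.inner_eq_star_dotProduct, dotProduct_comm]
    have h3 := Complex.conj_eq_iff_im.2 (Complex.nonneg_iff.1 h1).2.symm
    exact h3
  rw [h2]
  obtain ⟨h3, h4⟩ := Complex.nonneg_iff.1 h1
  exact ⟨Complex.ext rfl h4, h3⟩

theorem trace_mul_nonneg {A B : Op d} (hA : A.PosSemidef) (hB : B.PosSemidef) :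
    0 ≤ (A * B).trace := by
  obtain ⟨m, v, rfl⟩ := posSemidef_iff_eq_sum_vecMulVec.1 hB
  rw [Finset.mul_sum, trace_sum]
  refine Finset.sum_nonneg fun i _ => ?_
  rw [trace_mul_vecMulVec_star]
  exact hA.dotProduct_mulVec_nonneg _

/-- Positivity is complete positivity with a one-dimensional ancilla. -/
theorem IsCPTP.posSemidef {Φ : SuperOp d} (h : IsCPTP Φ) {A : Op d} (hA : A.PosSemidef) :
    (Φ A).PosSemidef :=
  (h.1 1 (A.submatrix Prod.fst Prod.fst) (hA.submatrix _)).submatrix fun i => (i, 0)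

/-- The Heisenberg picture: the dual of a CPTP map preserves Hermitian contractions. -/
theorem IsCPTP.exists_dual {Φ : SuperOp d} (h : IsCPTP Φ) {K : Op d}
    (hK : IsHermitianContraction K) :
    ∃ B : Op d, IsHermitianContraction B ∧ ∀ A, (B * A).trace = (K * Φ A).trace := by
  let B : Op d := Matrix.of fun i j => (K * Φ (single j i 1)).trace
  have hB : ∀ A, (B * A).trace = (K * Φ A).trace := by
    intro A
    conv_rhs => rw [matrix_eq_sum_single A]
    simp only [map_sum, Finset.mul_sum, trace_sum]
    rw [Finset.sum_comm]
    simp only [trace, diag_apply, mul_apply (M := B)]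
    refine Finset.sum_congr rfl fun i _ => Finset.sum_congr rfl fun j _ => ?_
    have : single j i (A j i) = A j i • single j i (1 : ℂ) := by simp
    rw [this, map_smul, mul_smul_comm]
    simp [B, trace, mul_comm, Finset.mul_sum]
  have hv : ∀ v : Fin d → ℂ, (Φ (vecMulVec v (star v))).PosSemidef := fun v =>
    h.posSemidef (posSemidef_vecMulVec_self_star v)
  -- By trace preservation, `Tr((1 ± B) v v†) = Tr((1 ± K) Φ(v v†))`, which is nonnegative.
  refine ⟨B, ⟨posSemidef_of_trace_nonneg fun v => ?_, posSemidef_of_trace_nonneg fun v => ?_⟩, hB⟩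
  · have := trace_mul_nonneg hK.1 (hv v)
    rwa [sub_mul, trace_sub, one_mul, ← hB, h.2, ← trace_sub, ← one_mul (vecMulVec _ _),
      ← mul_assoc, ← sub_mul, mul_one] at this
  · have := trace_mul_nonneg hK.2 (hv v)
    rwa [add_mul, trace_add, one_mul, ← hB, h.2, ← trace_add, ← one_mul (vecMulVec _ _),
      ← mul_assoc, ← add_mul, mul_one] at this

attribute [local instance] Matrix.linftyOpNormedRing Matrix.linftyOpNormedAlgebra

/-- The matrix of a superoperator in the basis of matrix units. -/
noncomputable abbrev superMatrix (L : SuperOp d) : Matrix (Fin d × Fin d) (Fin d × Fin d) ℂ :=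
  LinearMap.toMatrixAlgEquiv (Matrix.stdBasis ℂ (Fin d) (Fin d)) L

/-- The functional `N ↦ Tr(K N(ρ))` on matrices representing superoperators. -/
noncomputable def traceFunctional (K ρ : Op d) : Matrix (Fin d × Fin d) (Fin d × Fin d) ℂ →L[ℝ] ℂ :=
  LinearMap.toContinuousLinearMap
    { toFun := fun N =>
        (K * (LinearMap.toMatrixAlgEquiv (Matrix.stdBasis ℂ (Fin d) (Fin d))).symm N ρ).trace
      map_add' := fun N N' => by simp [mul_add]
      map_smul' := fun c N => by
        have : c • N = (c : ℂ) • N := rfl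
        rw [this, map_smul, LinearMap.smul_apply, mul_smul_comm, trace_smul]
        rfl }

theorem traceFunctional_apply (K ρ : Op d) (N : Matrix (Fin d × Fin d) (Fin d × Fin d) ℂ) :
    traceFunctional K ρ N
      = (K * (LinearMap.toMatrixAlgEquiv (Matrix.stdBasis ℂ (Fin d) (Fin d))).symm N ρ).trace :=
  rfl

theorem evolve_eq (L : SuperOp d) (s : ℝ) :
    evolve L s = (LinearMap.toMatrixAlgEquiv (Matrix.stdBasis ℂ (Fin d) (Fin d))).symm
      (NormedSpace.exp (s • superMatrix L)) := rfl

/-- Duhamel's formula in integrated form: the outputs of two semigroups differ by at most `t`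
times the size of the difference of their generators. -/
theorem norm_trace_evolve_sub_le {L L' : SuperOp d} (hL : IsGKSL L) (hL' : IsGKSL L')
    {ρ K : Op d} (hρ : ρ.PosSemidef) (hρ1 : ρ.trace = 1) (hK : IsHermitianContraction K)
    {t c : ℝ} (ht : 0 ≤ t)
    (hc : ∀ σ B : Op d, σ.PosSemidef → σ.trace = 1 → IsHermitianContraction B →
      ‖(B * (L' - L) σ).trace‖ ≤ c) :
    ‖(K * evolve L' t ρ).trace - (K * evolve L t ρ).trace‖ ≤ c * t := by
  set a := superMatrix L with ha
  set a' := superMatrix L' with ha'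
  -- The path `e^{(t-s)L} e^{sL'}` interpolates between the two semigroups.
  have hd : ∀ s : ℝ, HasDerivAt
      (fun s : ℝ => NormedSpace.exp ((t - s) • a) * NormedSpace.exp (s • a'))
      (NormedSpace.exp ((t - s) • a) * ((a' - a) * NormedSpace.exp (s • a'))) s := by
    intro s
    have h1 := (hasDerivAt_exp_smul_const a (t - s)).scomp s ((hasDerivAt_id s).const_sub t)
    have h2 := hasDerivAt_exp_smul_const' a' s
    refine (h1.mul h2).congr_deriv ?_
    simp only [Function.comp, neg_smul, one_smul, neg_mul, sub_mul, mul_sub, mul_assoc]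
    exact (sub_eq_neg_add _ _).symm
  have hψ : ∀ s : ℝ, HasDerivAt (fun s : ℝ => traceFunctional K ρ
      (NormedSpace.exp ((t - s) • a) * NormedSpace.exp (s • a')))
      (traceFunctional K ρ
        (NormedSpace.exp ((t - s) • a) * ((a' - a) * NormedSpace.exp (s • a')))) s :=
    fun s => (traceFunctional K ρ).hasFDerivAt.comp_hasDerivAt s (hd s)
  have key := norm_image_sub_le_of_norm_deriv_le_segment' (a := 0) (b := t) (C := c)
    (fun s _ => (hψ s).hasDerivWithinAt) (by
      intro s hs
      -- The left factor is moved onto `K` and the right one onto `ρ`, giving again a contraction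
      -- and a state, so `hc` applies.
      obtain ⟨B, hB, hBt⟩ := (hL (t - s) (by linarith [hs.2])).exists_dual hK
      have hσ := hL' s hs.1
      rw [traceFunctional_apply, map_mul, map_mul, ← evolve_eq, ← evolve_eq, map_sub, ha, ha',
        AlgEquiv.symm_apply_apply, AlgEquiv.symm_apply_apply, Module.End.mul_apply,
        Module.End.mul_apply, ← hBt]
      exact hc _ _ (hσ.posSemidef hρ) ((hσ.2 ρ).trans hρ1) hB) t ⟨ht, le_rfl⟩
  simpa [traceFunctional_apply, ha, ha', evolve_eq] using key

theorem continuous_output {M : ℕ} {X : Type*} [Fintype X] {δ C_G : ℝ}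
    (E : SphereEnsemble d M X δ C_G) (t : ℝ) (x : X) :
    Continuous fun θ => E.outputAt t θ x := by
  have h : (fun θ => E.outputAt t θ x) = fun θ : ParamSphere M =>
      (traceFunctional (E.povm x) E.ρin (NormedSpace.exp (t • (superMatrix E.Lref +
        ((δ / Real.sqrt M : ℝ) : ℂ) • ∑ j, (((θ : EuclideanSpace ℝ (Fin M)) j : ℝ) : ℂ)
          • superMatrix (E.G j))))).re := by
    funext θ
    simp only [traceFunctional_apply, superMatrix, ← map_smul, ← map_sum, ← map_add]
    rfl
  rw [h]
  have hj : ∀ j, Continuous fun θ : ParamSphere M =>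
      (((θ : EuclideanSpace ℝ (Fin M)) j : ℝ) : ℂ) • superMatrix (E.G j) := fun j =>
    Continuous.smul (Complex.continuous_ofReal.comp (by fun_prop)) continuous_const
  have hsum : Continuous fun θ : ParamSphere M => t • (superMatrix E.Lref +
      ((δ / Real.sqrt M : ℝ) : ℂ) • ∑ j, (((θ : EuclideanSpace ℝ (Fin M)) j : ℝ) : ℂ)
        • superMatrix (E.G j)) := by
    refine Continuous.fun_const_smul (Continuous.fun_add continuous_const ?_) t
    exact Continuous.fun_const_smul (continuous_finsetSum _ fun j _ => hj j) _
  have hexp : Continuous (NormedSpace.exp : Matrix (Fin d × Fin d) (Fin d × Fin d) ℂ → _) :=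
    NormedSpace.exp_continuous
  exact Complex.continuous_re.comp ((traceFunctional _ _).continuous.comp (hexp.comp hsum))

end Evolution
-- Lipschitz dependence of the output on the parameters
section Lipschitz
open Matrix

variable {d M : ℕ} {X : Type*} [Fintype X] {δ C_G t : ℝ}

theorem traceNorm_apply_le {T : SuperOp d} {C : ℝ} (hC : 0 ≤ C)
    (hT : oneToOneNorm T ≤ ENNReal.ofReal C) {σ : Op d} (hσ : σ.PosSemidef)
    (hσ1 : σ.trace = 1) : traceNorm (T σ) ≤ C := by
  have h0 : σ ≠ 0 := by rintro rfl; simp at hσ1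
  have h1 : traceNorm σ = 1 := by
    have := traceNorm_eq_of_posSemidef hσ
    rw [hσ1] at this
    exact_mod_cast this
  have h2 := (le_iSup₂ (f := fun (A : Op d) (_ : A ≠ 0) =>
    ENNReal.ofReal (traceNorm (T A) / traceNorm A)) σ h0).trans hT
  rw [h1, div_one] at h2
  exact (ENNReal.ofReal_le_ofReal_iff hC).1 h2

theorem sum_abs_le_sqrt_mul_norm (v : EuclideanSpace ℝ (Fin M)) :
    ∑ j, |v j| ≤ Real.sqrt M * ‖v‖ := by
  have h := Real.sum_mul_le_sqrt_mul_sqrt Finset.univ (fun _ : Fin M => (1 : ℝ)) fun j => |v j|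
  simpa [EuclideanSpace.norm_eq] using h

theorem lindbladian_sub (Lref : SuperOp d) (G : Fin M → SuperOp d) (θ θ' : ParamSphere M) :
    lindbladian δ Lref G θ' - lindbladian δ Lref G θ = ((δ / Real.sqrt M : ℝ) : ℂ) •
      ∑ j, ((((θ' : EuclideanSpace ℝ (Fin M)) - θ) j : ℝ) : ℂ) • G j := by
  rw [lindbladian, lindbladian, add_sub_add_left_eq_sub]
  refine (smul_sub _ _ _).symm.trans (congrArg _ ?_)
  refine (Finset.sum_sub_distrib _ _).symm.trans (Finset.sum_congr rfl fun j _ => ?_)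
  rw [PiLp.sub_apply, Complex.ofReal_sub]
  exact (sub_smul _ _ _).symm

namespace SphereEnsemble

theorem norm_trace_lindbladian_sub_le (E : SphereEnsemble d M X δ C_G) (hδ : 0 ≤ δ)
    (hC : 0 ≤ C_G) (θ θ' : ParamSphere M) {σ B : Op d} (hσ : σ.PosSemidef) (hσ1 : σ.trace = 1)
    (hB : IsHermitianContraction B) :
    ‖(B * (lindbladian δ E.Lref E.G θ' - lindbladian δ E.Lref E.G θ) σ).trace‖
      ≤ δ * C_G * dist θ θ' := by
  rw [lindbladian_sub]
  set v : EuclideanSpace ℝ (Fin M) := θ' - θ with hv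
  have hterm : ∀ j, ‖(B * E.G j σ).trace‖ ≤ C_G := fun j =>
    (norm_trace_mul_le hB _).trans (traceNorm_apply_le hC (E.norm_G_le j) hσ hσ1)
  have hdist : dist θ θ' = ‖v‖ := by rw [dist_comm, Subtype.dist_eq, dist_eq_norm]
  simp only [LinearMap.smul_apply, LinearMap.sum_apply, mul_smul_comm, trace_smul, Finset.mul_sum,
    trace_sum, smul_eq_mul]
  rw [← Finset.mul_sum, norm_mul, Complex.norm_real, Real.norm_of_nonneg (by positivity)]
  calc δ / Real.sqrt M * ‖∑ j, ((v j : ℝ) : ℂ) * (B * E.G j σ).trace‖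
      ≤ δ / Real.sqrt M * ∑ j, |v j| * C_G := by
        gcongr
        refine (norm_sum_le _ _).trans (Finset.sum_le_sum fun j _ => ?_)
        rw [norm_mul, Complex.norm_real, Real.norm_eq_abs]
        gcongr
        exact hterm j
    _ = δ / Real.sqrt M * C_G * ∑ j, |v j| := by rw [← Finset.sum_mul]; ring
    _ ≤ δ / Real.sqrt M * C_G * (Real.sqrt M * ‖v‖) := by
        gcongr
        exact sum_abs_le_sqrt_mul_norm v
    _ = (Real.sqrt M / Real.sqrt M) * (δ * C_G * ‖v‖) := by ring
    -- An inequality, since the quotient is `0` when `M = 0`.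
    _ ≤ 1 * (δ * C_G * ‖v‖) := by
        gcongr
        exact div_self_le_one _
    _ = _ := by rw [one_mul, hdist]

theorem isHermitianContraction_sum (E : SphereEnsemble d M X δ C_G) {s : X → ℝ}
    (hs : ∀ x, |s x| ≤ 1) : IsHermitianContraction (∑ x, s x • E.povm x) := by
  constructor
  · rw [← E.sum_povm, ← Finset.sum_sub_distrib]
    refine posSemidef_sum _ fun x _ => ?_
    have := (E.posSemidef_povm x).smul (sub_nonneg.2 (abs_le.1 (hs x)).2)
    rwa [sub_smul, one_smul] at this
  · rw [← E.sum_povm, ← Finset.sum_add_distrib]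
    refine posSemidef_sum _ fun x _ => ?_
    have := (E.posSemidef_povm x).smul (neg_le_iff_add_nonneg'.1 (abs_le.1 (hs x)).1)
    rwa [add_smul, one_smul] at this

/-- Weighting the POVM by the signs of the differences gives a single Hermitian contraction, so no
factor of `|X|` appears. -/
theorem sum_abs_outputAt_sub_le (E : SphereEnsemble d M X δ C_G) (ht : 0 ≤ t) (hδ : 0 ≤ δ)
    (hC : 0 ≤ C_G) {θ θ' : ParamSphere M} (hθ : θ ∈ E.Θ) (hθ' : θ' ∈ E.Θ) :
    ∑ x, |E.outputAt t θ' x - E.outputAt t θ x| ≤ t * δ * C_G * dist θ θ' := by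
  set s : X → ℝ := fun x => if 0 ≤ E.outputAt t θ' x - E.outputAt t θ x then 1 else -1 with hs
  have hs1 : ∀ x, |s x| ≤ 1 := fun x => by simp only [hs]; split_ifs <;> simp
  have hK := E.isHermitianContraction_sum hs1
  have hsum : ∑ x, |E.outputAt t θ' x - E.outputAt t θ x|
      = ((((∑ x, s x • E.povm x) * evolve (lindbladian δ E.Lref E.G θ') t E.ρin).trace)
        - ((∑ x, s x • E.povm x) * evolve (lindbladian δ E.Lref E.G θ) t E.ρin).trace).re := by
    simp only [Finset.sum_mul, trace_sum, ← Finset.sum_sub_distrib, Complex.re_sum]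
    refine Finset.sum_congr rfl fun x _ => ?_
    rw [smul_mul_assoc, smul_mul_assoc, trace_smul, trace_smul, ← smul_sub, Complex.smul_re,
      Complex.sub_re]
    change _ = s x • (E.outputAt t θ' x - E.outputAt t θ x)
    simp only [hs]
    split_ifs with h
    · rw [abs_of_nonneg h, one_smul]
    · rw [abs_of_neg (not_le.1 h)]; simp
  rw [hsum]
  refine (Complex.re_le_norm _).trans ?_
  refine (norm_trace_evolve_sub_le (E.isGKSL_of_mem θ hθ) (E.isGKSL_of_mem θ' hθ')
    E.posSemidef_ρin E.trace_ρin hK ht fun σ B hσ hσ1 hB =>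
      E.norm_trace_lindbladian_sub_le hδ hC θ θ' hσ hσ1 hB).trans (le_of_eq (by ring))

end SphereEnsemble

theorem tvDist_comm (P Q : X → ℝ) : tvDist P Q = tvDist Q P := by
  simp only [tvDist, abs_sub_comm]

theorem tvDist_triangle (P Q R : X → ℝ) : tvDist P R ≤ tvDist P Q + tvDist Q R := by
  simp only [tvDist, ← mul_add, ← Finset.sum_add_distrib]
  gcongr
  exact abs_sub_le _ _ _

theorem tvDist_le_one {P Q : X → ℝ} (hP : P ∈ stdSimplex ℝ X) (hQ : Q ∈ stdSimplex ℝ X) :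
    tvDist P Q ≤ 1 := by
  have h : ∑ x, |P x - Q x| ≤ ∑ x, (P x + Q x) := Finset.sum_le_sum fun x _ => by
    rw [abs_le]; constructor <;> linarith [hP.1 x, hQ.1 x]
  rw [Finset.sum_add_distrib, hP.2, hQ.2] at h
  unfold tvDist
  linarith

namespace SphereEnsemble

theorem outputAt_mem_stdSimplex (E : SphereEnsemble d M X δ C_G) (ht : 0 ≤ t)
    {θ : ParamSphere M} (hθ : θ ∈ E.Θ) : E.outputAt t θ ∈ stdSimplex ℝ X := by
  have h := E.isGKSL_of_mem θ hθ t ht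
  refine ⟨fun x => ?_, ?_⟩
  · exact (Complex.nonneg_iff.1 (trace_mul_nonneg (E.posSemidef_povm x)
      (h.posSemidef E.posSemidef_ρin))).1
  · simp only [outputAt, output, ← Complex.re_sum, ← trace_sum, ← Finset.sum_mul, E.sum_povm,
      one_mul, h.2, E.trace_ρin, Complex.one_re]

theorem lipschitzOnWith_tvDist (E : SphereEnsemble d M X δ C_G) (ht : 0 ≤ t) (hδ : 0 ≤ δ)
    (hC : 0 ≤ C_G) (D : X → ℝ) :
    LipschitzOnWith (t * δ * C_G).toNNReal (fun θ => tvDist (E.outputAt t θ) D) E.Θ := by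
  refine LipschitzOnWith.of_le_add_mul _ fun θ hθ θ' hθ' => ?_
  have h1 := tvDist_triangle (E.outputAt t θ) (E.outputAt t θ') D
  have h2 := E.sum_abs_outputAt_sub_le ht hδ hC hθ' hθ
  have h3 : tvDist (E.outputAt t θ) (E.outputAt t θ') ≤ t * δ * C_G * dist θ θ' := by
    rw [dist_comm]
    -- The factor `1 / 2` of the total variation is given away.
    refine le_trans ?_ h2
    have := Finset.sum_nonneg (s := Finset.univ)
      fun x _ => abs_nonneg (E.outputAt t θ x - E.outputAt t θ' x)
    unfold tvDist
    linarith
  rw [Real.coe_toNNReal _ (by positivity)]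
  linarith

theorem continuous_tvDist (E : SphereEnsemble d M X δ C_G) (t : ℝ) (D : X → ℝ) :
    Continuous fun θ => tvDist (E.outputAt t θ) D :=
  continuous_const.mul (continuous_finsetSum _ fun x _ =>
    ((continuous_output E t x).sub continuous_const).abs)

end SphereEnsemble
end Lipschitz
-- Mean distance and lower-tail bounds
section Probability

variable {d M : ℕ} {X : Type*} [Fintype X] {δ C_G t : ℝ}

instance (M : ℕ) : IsFiniteMeasure (surfaceMeasure M) := by
  unfold surfaceMeasure; infer_instance

namespace SphereEnsemble

theorem isProbabilityMeasure_paramMeasure (E : SphereEnsemble d M X δ C_G) :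
    IsProbabilityMeasure (paramMeasure E.Θ) :=
  ProbabilityTheory.cond_isProbabilityMeasure E.measure_Θ_ne_zero

theorem integrable_of_continuous (E : SphereEnsemble d M X δ C_G) {f : ParamSphere M → ℝ}
    (hf : Continuous f) : Integrable f (paramMeasure E.Θ) := by
  have := E.isProbabilityMeasure_paramMeasure
  exact hf.integrable_of_hasCompactSupport (HasCompactSupport.of_compactSpace f)

/-- Jensen's inequality for the convex function `P ↦ d_TV(P, D)`. -/
theorem tvDist_meanOutput_le (E : SphereEnsemble d M X δ C_G) (t : ℝ) (D : X → ℝ) :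
    tvDist (E.meanOutput t) D ≤ ∫ θ, tvDist (E.outputAt t θ) D ∂(paramMeasure E.Θ) := by
  have := E.isProbabilityMeasure_paramMeasure
  have hc : ∀ x, Continuous fun θ => E.outputAt t θ x - D x := fun x =>
    (continuous_output E t x).sub continuous_const
  simp only [tvDist]
  rw [integral_const_mul, integral_finsetSum _ fun x _ => E.integrable_of_continuous (hc x).abs]
  gcongr with x
  have h : E.meanOutput t x - D x = ∫ θ, (E.outputAt t θ x - D x) ∂(paramMeasure E.Θ) := by
    rw [integral_sub (E.integrable_of_continuous (continuous_output E t x)) (integrable_const _)]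
    simp [meanOutput]
  rw [h]
  exact abs_integral_le_integral_abs

/-- Triangle inequality through `D`, with Jensen for the second leg; it transfers the mean
assumption from `Q` to every `D`. -/
theorem meanTV_le (E : SphereEnsemble d M X δ C_G) (t : ℝ) (D : X → ℝ) :
    E.meanTV t ≤ 2 * ∫ θ, tvDist (E.outputAt t θ) D ∂(paramMeasure E.Θ) := by
  have := E.isProbabilityMeasure_paramMeasure
  have h1 : E.meanTV t ≤ ∫ θ, (tvDist (E.outputAt t θ) D + tvDist D (E.meanOutput t))
      ∂(paramMeasure E.Θ) :=
    integral_mono (E.integrable_of_continuous (E.continuous_tvDist t _))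
      (E.integrable_of_continuous ((E.continuous_tvDist t D).add continuous_const))
      fun θ => tvDist_triangle _ _ _
  rw [integral_add (E.integrable_of_continuous (E.continuous_tvDist t D)) (integrable_const _),
    integral_const, probReal_univ, one_smul, tvDist_comm D] at h1
  linarith [E.tvDist_meanOutput_le t D]

theorem prob_ge_of_real_le (E : SphereEnsemble d M X δ C_G) {D : X → ℝ} {ε b : ℝ}
    (h : (paramMeasure E.Θ).real {θ | tvDist (E.outputAt t θ) D < ε} ≤ b) :
    1 - b ≤ E.prob t fun P => ε ≤ tvDist P D := by
  have := E.isProbabilityMeasure_paramMeasure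
  have hm : MeasurableSet {θ | tvDist (E.outputAt t θ) D < ε} :=
    measurableSet_lt (E.continuous_tvDist t D).measurable measurable_const
  have h2 := probReal_compl_eq_one_sub (μ := paramMeasure E.Θ) hm
  simp only [Set.compl_ofPred, not_lt] at h2
  rw [prob, h2]
  linarith

theorem real_tvDist_lt_le_of_levyConcentration (E : SphereEnsemble d M X δ C_G) (ht : 0 < t)
    (hδ : 0 < δ) (hC : 0 < C_G) {c : ℝ} (hE : LevyConcentration c E.Θ) {D : X → ℝ} {ε : ℝ}
    (hε : 0 < ε) (hmean : 4 * ε ≤ ∫ θ, tvDist (E.outputAt t θ) D ∂(paramMeasure E.Θ)) :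
    (paramMeasure E.Θ).real {θ | tvDist (E.outputAt t θ) D < ε}
      ≤ 2 * Real.exp (-(c * (2 * ε) ^ 2 / (t * δ * C_G) ^ 2 * M)) := by
  have := E.isProbabilityMeasure_paramMeasure
  have hL : 0 < t * δ * C_G := by positivity
  have h := hE (t * δ * C_G).toNNReal _ (Real.toNNReal_pos.2 hL)
    (E.lipschitzOnWith_tvDist ht.le hδ.le hC.le D) (2 * ε) (by positivity)
  rw [Real.coe_toNNReal _ hL.le] at h
  refine (measureReal_mono fun θ hθ => ?_).trans (h.trans_eq ?_)
  · simp only [Set.mem_ofPred_eq] at hθ ⊢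
    rw [abs_sub_comm]
    exact le_trans (by linarith) (le_abs_self _)
  · congr 3
    ring

theorem paramMeasure_real_apply (E : SphereEnsemble d M X δ C_G)
    (hE : surfaceMeasure M E.Θᶜ = 0) (S : Set (ParamSphere M)) :
    (paramMeasure E.Θ).real S
      = (surfaceMeasure M).real (S ∩ E.Θ) / (surfaceMeasure M).real Set.univ := by
  have h1 : (surfaceMeasure M).real E.Θ = (surfaceMeasure M).real Set.univ := by
    rw [measureReal_def, measureReal_def, measure_of_measure_compl_eq_zero hE]
  rw [paramMeasure, measureReal_def, ProbabilityTheory.cond_apply E.measurableSet_Θ,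
    ENNReal.toReal_mul, ENNReal.toReal_inv, ← measureReal_def, ← measureReal_def, h1,
    Set.inter_comm]
  ring

theorem real_tvDist_mul_le (E : SphereEnsemble d M X δ C_G) (ht : 0 < t)
    (hδ : 0 < δ) (hC : 0 < C_G) (hE : surfaceMeasure M E.Θᶜ = 0) {D : X → ℝ} {ε r : ℝ}
    (hr : 0 ≤ r) (hr1 : r ≤ 1) (hrε : t * δ * C_G * r ≤ ε) :
    (paramMeasure E.Θ).real {θ | tvDist (E.outputAt t θ) D < ε}
        * (paramMeasure E.Θ).real {θ | 2 * ε ≤ tvDist (E.outputAt t θ) D}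
      ≤ Real.exp (-(r ^ 2 / 4 * M)) := by
  have hcont := (E.continuous_tvDist t D).measurable
  have hL : 0 < t * δ * C_G := by positivity
  have h := surfaceMeasure_mul_le (r := r)
    ((measurableSet_lt hcont (measurable_const (a := ε))).inter E.measurableSet_Θ)
    -- The distance to `D` jumps by more than `ε ≥ t δ C_G r` between the sets, so they are
    -- `r`-separated. The Lipschitz bound holds only on `Θ`, hence the intersections.
    ((measurableSet_le (measurable_const (a := 2 * ε)) hcont).inter E.measurableSet_Θ) hr hr1 (by
      rintro θ ⟨h1, hθ⟩ θ' ⟨h2, hθ'⟩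
      have h3 := (E.lipschitzOnWith_tvDist ht.le hδ.le hC.le D).dist_le_mul θ' hθ' θ hθ
      rw [Real.coe_toNNReal _ hL.le, Real.dist_eq] at h3
      simp only [Set.mem_ofPred_eq] at h1 h2
      have h4 : t * δ * C_G * r ≤ t * δ * C_G * dist θ' θ := by
        refine le_trans ?_ (le_trans (le_abs_self _) h3)
        linarith
      rw [dist_comm]
      exact le_of_mul_le_mul_left h4 hL)
  have hu : 0 < (surfaceMeasure M).real Set.univ := by
    rw [measureReal_def]
    refine ENNReal.toReal_pos (fun h0 => E.measure_Θ_ne_zero ?_) (measure_ne_top _ _)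
    exact measure_mono_null (Set.subset_univ _) h0
  rw [E.paramMeasure_real_apply hE, E.paramMeasure_real_apply hE, div_mul_div_comm,
    div_le_iff₀ (by positivity), ← sq]
  exact h

/-- As the distance is at most `1` on `Θ`, its mean is at most `2ε` plus the probability in
question. -/
theorem le_real_tvDist_ge (E : SphereEnsemble d M X δ C_G) (ht : 0 ≤ t) {D : X → ℝ}
    (hD : D ∈ stdSimplex ℝ X) {ε : ℝ}
    (hε : 0 ≤ ε) (hmean : 4 * ε ≤ ∫ θ, tvDist (E.outputAt t θ) D ∂(paramMeasure E.Θ)) :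
    2 * ε ≤ (paramMeasure E.Θ).real {θ | 2 * ε ≤ tvDist (E.outputAt t θ) D} := by
  have := E.isProbabilityMeasure_paramMeasure
  set S := {θ | 2 * ε ≤ tvDist (E.outputAt t θ) D} with hS
  have hSm : MeasurableSet S :=
    measurableSet_le measurable_const (E.continuous_tvDist t D).measurable
  have hi : Integrable (S.indicator fun _ => (1 : ℝ)) (paramMeasure E.Θ) :=
    (integrable_const 1).indicator hSm
  have h1 : ∫ θ, tvDist (E.outputAt t θ) D ∂(paramMeasure E.Θ)
      ≤ ∫ θ, (2 * ε + S.indicator (fun _ => (1 : ℝ)) θ) ∂(paramMeasure E.Θ) := by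
    refine integral_mono_ae (E.integrable_of_continuous (E.continuous_tvDist t D))
      ((integrable_const _).add hi) ?_
    filter_upwards [ProbabilityTheory.ae_cond_mem E.measurableSet_Θ] with θ hθ
    by_cases h : θ ∈ S
    · rw [Set.indicator_of_mem h]
      linarith [tvDist_le_one (E.outputAt_mem_stdSimplex ht hθ) hD]
    · rw [Set.indicator_of_notMem h, add_zero]
      exact (not_le.1 h).le
  rw [integral_add (integrable_const _) hi, integral_const, probReal_univ, one_smul,
    integral_indicator_const _ hSm, smul_eq_mul, mul_one] at h1
  linarith

end SphereEnsemble
end Probability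
end RandomLindbladian

/-! ### Choice of constants and conclusion -/

open RandomLindbladian in
theorem mainTheorem7 (t δ C_G m₀ c_par : ℝ)
    (ht : 0 < t) (hδ : 0 < δ) (hC : 0 < C_G) (hm₀ : 0 < m₀) (hc : 0 < c_par) :
    ∃ ε : ℝ, 0 < ε ∧ ∃ c : ℝ, 0 < c ∧
      ∀ (ι : Type*) (d M : ι → ℕ) (X : ι → Type*) [∀ i, Fintype (X i)]
        (E : ∀ i, RandomLindbladian.SphereEnsemble (d i) (M i) (X i) δ C_G)
        (εmean : ι → ℝ),
        (∀ i, RandomLindbladian.surfaceMeasure (M i) (E i).Θᶜ = 0 ∨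
          RandomLindbladian.LevyConcentration c_par (E i).Θ) →
        Tendsto εmean (comap M atTop) (𝓝 0) →
        (∀ i, (E i).meanTV t ∈ Set.Icc (m₀ - εmean i) (m₀ + εmean i)) →
        ∃ M₀ : ℕ, ∀ i, M₀ ≤ M i → ∀ D ∈ stdSimplex ℝ (X i),
          (E i).prob t (fun P => ε ≤ RandomLindbladian.tvDist P D)
            ≥ 1 - 2 * Real.exp (-(c * M i)) := by
  -- Once `εmean ≤ m₀ / 2`, the mean distance to `D` is at least `m₀ / 4 = 4ε`.
  set ε : ℝ := m₀ / 16 with hε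
  have hε0 : 0 < ε := by positivity
  have hL : 0 < t * δ * C_G := by positivity
  set r : ℝ := min 1 (ε / (t * δ * C_G)) with hr
  have hr0 : 0 < r := lt_min one_pos (by positivity)
  have hrε : t * δ * C_G * r ≤ ε := by
    rw [mul_comm, ← le_div_iff₀ hL]
    exact min_le_right _ _
  set c₁ : ℝ := c_par * (2 * ε) ^ 2 / (t * δ * C_G) ^ 2 with hc₁
  -- Half of the exponent `r² / 4` is kept; the other half absorbs the factor `1 / (2ε)` for large
  -- `M`.
  refine ⟨ε, hε0, min (r ^ 2 / 8) c₁, lt_min (by positivity) (by positivity), ?_⟩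
  intro ι d M X _ E εmean hconc hlim hmean
  have hlim' : Tendsto (fun n : ℕ => Real.exp (-(r ^ 2 / 8 * n))) atTop (𝓝 0) :=
    Real.tendsto_exp_neg_atTop_nhds_zero.comp
      (tendsto_natCast_atTop_atTop.const_mul_atTop (by positivity))
  obtain ⟨M₁, hM₁⟩ := eventually_atTop.1 (hlim'.eventually_le_const (show 0 < 4 * ε by positivity))
  obtain ⟨s, hs, hsM⟩ := (hlim.eventually_le_const (show 0 < m₀ / 2 by positivity)).exists_mem
  obtain ⟨u, hu, hus⟩ := mem_comap.1 hs
  obtain ⟨M₂, hM₂⟩ := mem_atTop_sets.1 hu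
  refine ⟨max M₁ M₂, fun i hi D hD => ?_⟩
  have hεm : εmean i ≤ m₀ / 2 := hsM i (hus (hM₂ _ (le_of_max_le_right hi)))
  have hm : 4 * ε ≤ ∫ θ, tvDist ((E i).outputAt t θ) D ∂(paramMeasure (E i).Θ) := by
    have h1 := (hmean i).1
    have h2 := (E i).meanTV_le t D
    rw [hε]
    linarith
  refine (E i).prob_ge_of_real_le ?_
  rcases hconc i with hfull | hlevy
  · have h1 := (E i).real_tvDist_mul_le (D := D) ht hδ hC hfull hr0.le (min_le_left _ _) hrε
    have h2 := (E i).le_real_tvDist_ge ht.le hD hε0.le hm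
    have h3 := hM₁ (M i) (le_of_max_le_left hi)
    set p := (paramMeasure (E i).Θ).real {θ | tvDist ((E i).outputAt t θ) D < ε} with hp
    have hp0 : 0 ≤ p := measureReal_nonneg
    set e := Real.exp (-(r ^ 2 / 8 * M i)) with he
    have he2 : Real.exp (-(r ^ 2 / 4 * M i)) = e * e := by
      rw [he, ← Real.exp_add]; congr 1; ring
    have he0 : 0 < e := Real.exp_pos _
    have h4 : 2 * ε * p ≤ 2 * ε * (2 * e) := by
      calc 2 * ε * p ≤ p * (paramMeasure (E i).Θ).real
            {θ | 2 * ε ≤ tvDist ((E i).outputAt t θ) D} := by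
            rw [mul_comm]; gcongr
        _ ≤ e * e := he2 ▸ h1
        _ ≤ 4 * ε * e := by gcongr
        _ = _ := by ring
    refine (le_of_mul_le_mul_left h4 (by positivity)).trans ?_
    rw [he]
    gcongr
    exact min_le_left _ _
  · refine ((E i).real_tvDist_lt_le_of_levyConcentration ht hδ hC hlevy hε0 hm).trans ?_
    gcongr
    exact min_le_right _ _
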